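/- Let $E$ (states) and $A$ (actions) be Borel spaces, $\mathcal Z$ a measurable space, $N\in\mathbb N_0$ and $\beta>0$. For $n=0,\dots,N-1$ let $D_n\subseteq E\times A$ be a measurable set containing the graph of a measurable map $E\to A$, with sections $D_n(x)=\{a\in A:(x,a)\in D_n\}$; let $T_n:D_n\times\mathcal Z\to E$ and $c_n:D_n\times E\to\mathbb R_+$ be measurable; let $c_N:E\to\mathbb R_+$ be measurable; and let $Z_1,\dots,Z_N$ be independent $\mathcal Z$-valued random elements on a probability space $(\Omega,\mathcal A,\mathbb P)$. Assume: (i) every $D_n(x)$ is compact and $x\mapsto D_n(x)$ is upper semicontinuous, i.e. if $x_k\to x$ and $a_k\in D_n(x_k)$ for all $k$, then $(a_k)$ has an accumulation point in $D_n(x)$; (ii) $(x,a)\mapsto T_n(x,a,z)$ is continuous on $D_n$ for every $z\in\mathcal Z$; (iii) $c_n$ ($n<N$) and $c_N$ are lower semicontinuous. Let $\widehat E=E\times\mathbb R_+\times(0,\infty)$. A Markov policy is a tuple $\pi=(d_0,\dots,d_{N-1})$ of measurable maps $d_k:\widehat E\to A$ with $d_k(x,s,t)\in D_k(x)$. Given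 $n\in\{0,\dots,N\}$ and $(x,s,t)\in\widehat E$, let $(X_k,\mathbf s_k,\mathbf t_k)_{k=n}^{N}$ be the process with $(X_n,\mathbf s_n,\mathbf t_n)=(x,s,t)$ and, with $a_k=d_k(X_k,\mathbf s_k,\mathbf t_k)$, $$X_{k+1}=T_k(X_k,a_k,Z_{k+1}),\qquad \mathbf s_{k+1}=\mathbf s_k+\mathbf t_k\,c_k(X_k,a_k,X_{k+1}),\qquad \mathbf t_{k+1}=\beta\,\mathbf t_k .$$ For increasing convex $g:\mathbb R\to[0,\infty)$ put $$J^g_{n\pi}(x,s,t)=\mathbb E\Big[g\Big(s+t\Big(\sum_{k=n}^{N-1}\beta^{k-n}c_k(X_k,a_k,X_{k+1})+\beta^{N-n}c_N(X_N)\Big)\Big)\Big]\in[0,\infty],\qquad J^g_n(x,s,t)=\inf_{\pi}J^g_{n\pi}(x,s,t),$$ the infimum being over all Markov policies. Let $\phi:[0,1]\to\mathbb R_+$ be increasing with $\int_0^1\phi(u)\,du=1$, let $\bar\rho\in\mathbb R$, and let $\mathcal G$ be the set of increasing, convex, $\phi(1)$-Lipschitz functions $g:\mathbb R\to\mathbb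 R$ with $0\le g(x)\le\phi(1)x^++\bar\rho$ for all $x\in\mathbb R$, equipped with the metric of compact convergence $$m(g_1,g_2)=\sum_{j=1}^\infty 2^{-j}\,\frac{\max_{|s|\le j}|g_1(s)-g_2(s)|}{1+\max_{|s|\le j}|g_1(s)-g_2(s)|}.$$ Then for every $n=0,\dots,N$ the map $\mathcal G\times\widehat E\ni(g,x,s,t)\mapsto J^g_n(x,s,t)\in[0,\infty]$ is (jointly) lower semicontinuous. -/

import Mathlib

open MeasureTheory ProbabilityTheory Set Topology
open scoped NNReal ENNReal unitInterval

/-- A spectrum: an increasing function `φ : [0,1] → ℝ₊` with `∫₀¹ φ(u) du = 1`. Being real valued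
and increasing on `[0,1]`, it is bounded by `φ 1`. -/
structure IsSpectrum (φ : I → ℝ≥0) : Prop where
  monotone : Monotone φ
  lintegral_eq_one : ∫⁻ u, (φ u : ℝ≥0∞) = 1

/-- The space `𝒢` of increasing, convex, `φ(1)`-Lipschitz functions `g : ℝ → ℝ` with
`0 ≤ g(x) ≤ φ(1) x⁺ + ρ` for all real `x`. -/
structure GSpace (φ : I → ℝ≥0) (ρ : ℝ) where
  toFun : ℝ → ℝ
  monotone : Monotone toFun
  convexOn : ConvexOn ℝ univ toFun
  lipschitz : LipschitzWith (φ 1) toFun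
  nonneg : ∀ x, 0 ≤ toFun x
  le_bound : ∀ x, toFun x ≤ (φ 1 : ℝ) * max x 0 + ρ

/-- `max_{|s| ≤ j} |f(s) - g(s)|`; the maximum is attained for continuous `f` and `g`. -/
noncomputable def compactGap (f g : ℝ → ℝ) (j : ℕ) : ℝ :=
  sSup ((fun s => |f s - g s|) '' Icc (-(j : ℝ)) j)

/-- The metric of compact convergence
`m(f,g) = ∑_{j ≥ 1} 2^{-j} max_{|s| ≤ j} |f(s)-g(s)| / (1 + max_{|s| ≤ j} |f(s)-g(s)|)`;
the summation index below is `j - 1`. -/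
noncomputable def compactDist (f g : ℝ → ℝ) : ℝ :=
  ∑' j : ℕ, (1 / 2 : ℝ) ^ (j + 1) * (compactGap f g (j + 1) / (1 + compactGap f g (j + 1)))

theorem compactGap_nonneg (f g : ℝ → ℝ) (j : ℕ) : 0 ≤ compactGap f g j := by
  apply Real.sSup_nonneg
  rintro _ ⟨s, _, rfl⟩
  exact abs_nonneg _

theorem compactGap_bddAbove {f g : ℝ → ℝ} (hf : Continuous f) (hg : Continuous g) (j : ℕ) :
    BddAbove ((fun s => |f s - g s|) '' Icc (-(j : ℝ)) j) :=
  isCompact_Icc.bddAbove_image (by fun_prop)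

theorem le_compactGap {f g : ℝ → ℝ} (hf : Continuous f) (hg : Continuous g) {j : ℕ} {s : ℝ}
    (hs : s ∈ Icc (-(j : ℝ)) j) : |f s - g s| ≤ compactGap f g j :=
  le_csSup (compactGap_bddAbove hf hg j) ⟨s, hs, rfl⟩

theorem compactGap_triangle {f g h : ℝ → ℝ} (hf : Continuous f) (hg : Continuous g)
    (hh : Continuous h) (j : ℕ) :
    compactGap f h j ≤ compactGap f g j + compactGap g h j := by
  refine Real.sSup_le ?_ (add_nonneg (compactGap_nonneg _ _ _) (compactGap_nonneg _ _ _))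
  rintro _ ⟨s, hs, rfl⟩
  exact (abs_sub_le (f s) (g s) (h s)).trans
    (add_le_add (le_compactGap hf hg hs) (le_compactGap hg hh hs))

theorem compactDist_term_nonneg (f g : ℝ → ℝ) (j : ℕ) :
    0 ≤ (1 / 2 : ℝ) ^ (j + 1) * (compactGap f g (j + 1) / (1 + compactGap f g (j + 1))) := by
  have := compactGap_nonneg f g (j + 1)
  positivity

theorem compactDist_summable (f g : ℝ → ℝ) : Summable fun j : ℕ =>
    (1 / 2 : ℝ) ^ (j + 1) * (compactGap f g (j + 1) / (1 + compactGap f g (j + 1))) := by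
  have hs : Summable fun j : ℕ => (1 / 2 : ℝ) ^ (j + 1) :=
    (summable_nat_add_iff 1).2 summable_geometric_two
  refine Summable.of_nonneg_of_le (compactDist_term_nonneg f g) (fun j => ?_) hs
  have h := compactGap_nonneg f g (j + 1)
  have h1 : compactGap f g (j + 1) / (1 + compactGap f g (j + 1)) ≤ 1 :=
    div_le_one_of_le₀ (by linarith) (by linarith)
  exact mul_le_of_le_one_right (by positivity) h1

theorem compactDist_triangle {f g h : ℝ → ℝ} (hf : Continuous f) (hg : Continuous g)
    (hh : Continuous h) : compactDist f h ≤ compactDist f g + compactDist g h := by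
  unfold compactDist
  rw [← (compactDist_summable f g).tsum_add (compactDist_summable g h)]
  refine (compactDist_summable f h).tsum_le_tsum (fun j => ?_)
    ((compactDist_summable f g).add (compactDist_summable g h))
  rw [← mul_add]
  refine mul_le_mul_of_nonneg_left ?_ (by positivity)
  have ha := compactGap_nonneg f g (j + 1)
  have hb := compactGap_nonneg g h (j + 1)
  have hc := compactGap_nonneg f h (j + 1)
  have ht := compactGap_triangle hf hg hh (j + 1)
  generalize compactGap f g (j + 1) = a at *
  generalize compactGap g h (j + 1) = b at *
  generalize compactGap f h (j + 1) = c at *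
  calc c / (1 + c) ≤ (a + b) / (1 + (a + b)) := by
        rw [div_le_div_iff₀ (by linarith) (by linarith)]; nlinarith
    _ = a / (1 + (a + b)) + b / (1 + (a + b)) := by rw [add_div]
    _ ≤ a / (1 + a) + b / (1 + b) := by
        gcongr <;> linarith

theorem compactGap_self (f : ℝ → ℝ) (j : ℕ) : compactGap f f j = 0 := by
  refine le_antisymm (Real.sSup_le ?_ le_rfl) (compactGap_nonneg f f j)
  rintro _ ⟨s, _, rfl⟩
  simp

theorem eq_of_compactDist_eq_zero {f g : ℝ → ℝ} (hf : Continuous f) (hg : Continuous g)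
    (h : compactDist f g = 0) : f = g := by
  have h0 := (compactDist_summable f g).hasSum
  have h1 : (∑' j : ℕ, (1 / 2 : ℝ) ^ (j + 1) *
      (compactGap f g (j + 1) / (1 + compactGap f g (j + 1)))) = 0 := h
  rw [h1, hasSum_zero_iff_of_nonneg (compactDist_term_nonneg f g)] at h0
  funext s
  obtain ⟨j, hj⟩ := exists_nat_ge |s|
  have hz := congrFun h0 j
  have hn := compactGap_nonneg f g (j + 1)
  have hgap : compactGap f g (j + 1) = 0 := by
    rcases mul_eq_zero.1 hz with h2 | h2
    · exact absurd h2 (by positivity)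
    · rcases div_eq_zero_iff.1 h2 with h3 | h3 <;> linarith
  have hs : s ∈ Icc (-((j + 1 : ℕ) : ℝ)) ((j + 1 : ℕ) : ℝ) := by
    rw [mem_Icc, ← abs_le]; push_cast; linarith
  have := le_compactGap hf hg hs
  rw [hgap] at this
  exact sub_eq_zero.1 (abs_eq_zero.1 (le_antisymm this (abs_nonneg _)))

/-- `𝒢` carries the metric of compact convergence (and the topology of this metric). -/
noncomputable instance GSpace.instMetricSpace (φ : I → ℝ≥0) (ρ : ℝ) :
    MetricSpace (GSpace φ ρ) where
  dist f g := compactDist f.toFun g.toFun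
  dist_self f := by simp [compactDist, compactGap_self]
  dist_comm f g := by simp only [compactDist, compactGap, abs_sub_comm]
  dist_triangle f g h :=
    compactDist_triangle f.lipschitz.continuous g.lipschitz.continuous h.lipschitz.continuous
  eq_of_dist_eq_zero {f g} h := by
    have := eq_of_compactDist_eq_zero f.lipschitz.continuous g.lipschitz.continuous h
    cases f; cases g; cases this; rfl

/-- The extended state space `Ê = E × ℝ₊ × (0,∞)`: state, accumulated cost, discount. -/
abbrev ExtState (E : Type*) : Type _ := E × ℝ≥0 × Ioi (0 : ℝ≥0)

/-- A (non-stationary) Markov decision model with planning horizon `N`, state space `E`, action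
space `A` and disturbances in `𝒵` defined on the probability space `(Ω, P)`.
`Z n` is the disturbance that drives the transition from time `n` to time `n + 1`. -/
structure DecisionModel (E A 𝒵 Ω : Type*) [MeasurableSpace E] [MeasurableSpace A]
    [MeasurableSpace 𝒵] [MeasurableSpace Ω] (P : Measure Ω) (N : ℕ) where
  /-- possible state-action combinations -/
  D : Fin N → Set (E × A)
  measurableSet_D : ∀ n, MeasurableSet (D n)
  exists_graph_subset : ∀ n, ∃ f : E → A, Measurable f ∧ ∀ x, (x, f x) ∈ D n
  /-- transition functions -/
  T : (n : Fin N) → D n × 𝒵 → E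
  measurable_T : ∀ n, Measurable (T n)
  /-- one-stage cost `c n (x, a) x'` -/
  c : (n : Fin N) → D n × E → ℝ≥0
  measurable_c : ∀ n, Measurable (c n)
  /-- terminal cost -/
  cN : E → ℝ≥0
  measurable_cN : Measurable cN
  /-- disturbances -/
  Z : Fin N → Ω → 𝒵
  measurable_Z : ∀ n, Measurable (Z n)
  indep_Z : iIndepFun Z P
  /-- discount factor -/
  β : ℝ≥0
  β_pos : 0 < β

namespace DecisionModel

section

variable {E A 𝒵 Ω : Type*} [MeasurableSpace E] [MeasurableSpace A]
  [MeasurableSpace 𝒵] [MeasurableSpace Ω] {P : Measure Ω} {N : ℕ}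

/-- The continuity and compactness assumption on the model data. -/
structure ContinuityCompactness [TopologicalSpace E] [TopologicalSpace A]
    (M : DecisionModel E A 𝒵 Ω P N) : Prop where
  /-- the sets of admissible actions are compact -/
  isCompact_section : ∀ (n : Fin N) (x : E), IsCompact {a : A | (x, a) ∈ M.D n}
  /-- `x ↦ D n x` is upper semicontinuous: if `x_k → x` and `a_k ∈ D n x_k`, then `(a_k)` has an
  accumulation point in `D n x` -/
  upperSemicontinuous_section : ∀ (n : Fin N) (xs : ℕ → E) (x : E) (as : ℕ → A),
    Filter.Tendsto xs Filter.atTop (𝓝 x) → (∀ k, (xs k, as k) ∈ M.D n) →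
    ∃ a, (x, a) ∈ M.D n ∧ MapClusterPt a Filter.atTop as
  continuous_T : ∀ (n : Fin N) (z : 𝒵), Continuous fun q : M.D n => M.T n (q, z)
  lowerSemicontinuous_c : ∀ n, LowerSemicontinuous (M.c n)
  lowerSemicontinuous_cN : LowerSemicontinuous M.cN

/-- Transition function of the extended model:
`(x,s,t,a,z) ↦ (T n (x,a,z), s + t c n (x, a, T n (x,a,z)), β t)` for `(x,a) ∈ D n`. -/
def extT (M : DecisionModel E A 𝒵 Ω P N) (n : Fin N) (y : ExtState E) (a : A)
    (h : (y.1, a) ∈ M.D n) (z : 𝒵) : ExtState E :=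
  (M.T n (⟨(y.1, a), h⟩, z),
    y.2.1 + y.2.2 * M.c n (⟨(y.1, a), h⟩, M.T n (⟨(y.1, a), h⟩, z)),
    ⟨M.β * y.2.2, mul_pos M.β_pos y.2.2.2⟩)

/-- An `N`-stage Markov policy for the extended model: measurable decision rules
`d n : Ê → A` with `d n (x,s,t) ∈ D n x`. -/
structure MarkovPolicy (M : DecisionModel E A 𝒵 Ω P N) where
  rule : Fin N → ExtState E → A
  measurable_rule : ∀ n, Measurable (rule n)
  admissible : ∀ n y, (y.1, rule n y) ∈ M.D n

/-- The extended decision process under a Markov policy when it is in state `y` at time `n`: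
it equals `y` at all times `k ≤ n`, and from time `n` on it moves according to the policy, the
transition functions and the disturbances. Only the times `k ≥ n` are of interest. -/
def process (M : DecisionModel E A 𝒵 Ω P N) (π : M.MarkovPolicy) (n : Fin (N + 1))
    (y : ExtState E) (ω : Ω) (k : Fin (N + 1)) : ExtState E :=
  Fin.induction (motive := fun _ => ExtState E) y
    (fun j Y => if n ≤ j.castSucc then
      M.extT j Y (π.rule j Y) (π.admissible j Y) (M.Z j ω) else y) k

/-- The discounted cost from time `n` on,
`∑_{k=n}^{N-1} β^{k-n} c_k(X_k, d_k, X_{k+1}) + β^{N-n} c_N(X_N)`,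
when the extended process is in state `y` at time `n`. -/
noncomputable def costFrom (M : DecisionModel E A 𝒵 Ω P N) (π : M.MarkovPolicy)
    (n : Fin (N + 1)) (y : ExtState E) (ω : Ω) : ℝ≥0 :=
  ∑ k : Fin N with n ≤ k.castSucc, M.β ^ ((k : ℕ) - (n : ℕ)) *
      M.c k (⟨((M.process π n y ω k.castSucc).1, π.rule k (M.process π n y ω k.castSucc)),
        π.admissible k _⟩, (M.process π n y ω k.succ).1)
    + M.β ^ (N - (n : ℕ)) * M.cN (M.process π n y ω (Fin.last N)).1

/-- The value `J_{nπ}^g(x,s,t) = 𝔼_{n(x,s,t)}[g(s + t C)] ∈ [0,∞]` of a Markov policy, where `C` is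
the discounted cost from time `n` on. -/
noncomputable def policyValue (M : DecisionModel E A 𝒵 Ω P N) (π : M.MarkovPolicy) (g : ℝ → ℝ)
    (n : Fin (N + 1)) (y : ExtState E) : ℝ≥0∞ :=
  ∫⁻ ω, ENNReal.ofReal (g (y.2.1 + y.2.2 * M.costFrom π n y ω : ℝ≥0)) ∂P

/-- The value function `J_n^g(x,s,t)`: the infimum of the policy values over all Markov policies
of the extended model. -/
noncomputable def valueFunction (M : DecisionModel E A 𝒵 Ω P N) (g : ℝ → ℝ)
    (n : Fin (N + 1)) (y : ExtState E) : ℝ≥0∞ :=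
  ⨅ π : M.MarkovPolicy, M.policyValue π g n y

end

end DecisionModel

/-! Backward induction on `n` with a stronger claim (`valueFunction_structure`): the value function
is jointly lower semicontinuous, increasing in the accumulated cost `s`, and for each `g` attained
by one Markov policy at all states simultaneously. The induction step is the Bellman equation: the
value at time `j` is the infimum over actions of `actionValue W j`, with `W` the value at time `j +
1`.

The one-stage cost is only lower semicontinuous, so the extended transition need not be continuous;
monotonicity in `s` makes up for this (`LowerSemicontinuous.comp_monotone`). Fatou's lemma handles
the expectation, and compactness with upper semicontinuity of the action sets handles the infimum.
The Bellman equation itself rests on independence of the disturbances (`iIndepFun_lintegral_split`)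
and on a measurable minimiser (`exists_measurable_minimizer`), which is prepended to a policy
optimal from `j + 1` on. -/

/-! ### Measurable selection -/

/-- Compact-valued multifunctions whose hitting sets of closed sets are measurable admit a
measurable selection. -/
theorem exists_measurable_selection {Y A : Type*} [MeasurableSpace Y] [TopologicalSpace A]
    [T2Space A] [SecondCountableTopology A] [MeasurableSpace A] [BorelSpace A] (K : Y → Set A)
    (hK : ∀ y, IsCompact (K y)) (hne : ∀ y, (K y).Nonempty)
    (hmeas : ∀ C : Set A, IsClosed C → MeasurableSet {y | (K y ∩ C).Nonempty}) :
    ∃ f : Y → A, Measurable f ∧ ∀ y, f y ∈ K y := by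
  classical
  rcases isEmpty_or_nonempty Y with hY | ⟨⟨y₀⟩⟩
  · exact ⟨isEmptyElim, measurable_of_empty _, isEmptyElim⟩
  have hB : (TopologicalSpace.countableBasis A).Nonempty := by
    obtain ⟨a, -⟩ := hne y₀
    have ha : a ∈ ⋃₀ TopologicalSpace.countableBasis A :=
      (TopologicalSpace.isBasis_countableBasis A).sUnion_eq ▸ mem_univ a
    exact ⟨_, ha.choose_spec.1⟩
  obtain ⟨U, hU⟩ := (TopologicalSpace.countable_countableBasis A).exists_eq_range hB
  have hUo (i : ℕ) : IsOpen (U i) :=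
    TopologicalSpace.isOpen_of_mem_countableBasis (hU ▸ mem_range_self i)
  -- Remove the basic open set `U i` whenever some point survives. The sets stay nonempty and
  -- compact, so they have a common point; it is unique because some `U i` separates any two points.
  let L : ℕ → Y → Set A := fun i y => Nat.rec (K y)
    (fun i S => if (S ∩ (U i)ᶜ).Nonempty then S ∩ (U i)ᶜ else S) i
  have hL0 (y : Y) : L 0 y = K y := rfl
  have hLs (i : ℕ) (y : Y) : L (i + 1) y =
      if (L i y ∩ (U i)ᶜ).Nonempty then L i y ∩ (U i)ᶜ else L i y := rfl
  have hanti (i : ℕ) (y : Y) : L (i + 1) y ⊆ L i y := by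
    rw [hLs]; split_ifs
    · exact inter_subset_left
    · exact subset_rfl
  have hLne (i : ℕ) (y : Y) : (L i y).Nonempty := by
    induction i with
    | zero => exact hne y
    | succ i ih => rw [hLs]; split_ifs with h <;> assumption
  have hLc (i : ℕ) (y : Y) : IsCompact (L i y) := by
    induction i with
    | zero => exact hK y
    | succ i ih =>
      rw [hLs]; split_ifs with h
      · exact ih.inter_right (hUo i).isClosed_compl
      · exact ih
  have hLm (i : ℕ) : ∀ C : Set A, IsClosed C → MeasurableSet {y | (L i y ∩ C).Nonempty} := by
    induction i with
    | zero => exact hmeas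
    | succ i ih =>
      intro C hC
      have : {y | (L (i + 1) y ∩ C).Nonempty} =
          ({y | (L i y ∩ (U i)ᶜ).Nonempty} ∩ {y | (L i y ∩ ((U i)ᶜ ∩ C)).Nonempty}) ∪
          ({y | (L i y ∩ (U i)ᶜ).Nonempty}ᶜ ∩ {y | (L i y ∩ C).Nonempty}) := by
        ext y
        simp only [hLs, mem_ofPred_eq, mem_union, mem_inter_iff, mem_compl_iff]
        split_ifs with h <;> simp [h, inter_assoc]
      rw [this]
      have hc := (hUo i).isClosed_compl
      exact ((ih _ hc).inter (ih _ (hc.inter hC))).union ((ih _ hc).compl.inter (ih _ hC))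
  have hex (y : Y) : (⋂ i, L i y).Nonempty :=
    IsCompact.nonempty_iInter_of_sequence_nonempty_isCompact_isClosed _ (hanti · y) (hLne · y)
      (hLc 0 y) fun i => (hLc i y).isClosed
  choose f hf using hex
  have huniq (y : Y) (a : A) (ha : a ∈ ⋂ i, L i y) : a = f y := by
    by_contra hne
    obtain ⟨V, hV, haV, hVf⟩ := (TopologicalSpace.isBasis_countableBasis A).mem_nhds_iff.1
      (isOpen_compl_singleton.mem_nhds (show a ∈ ({f y}ᶜ : Set A) from hne))
    obtain ⟨i, rfl⟩ := hU ▸ hV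
    have h1 := mem_iInter.1 ha (i + 1)
    have h2 : f y ∈ L i y ∩ (U i)ᶜ := ⟨mem_iInter.1 (hf y) i, fun h => hVf h rfl⟩
    rw [hLs, if_pos ⟨_, h2⟩] at h1
    exact h1.2 haV
  refine ⟨f, measurable_of_isClosed fun C hC => ?_, fun y => mem_iInter.1 (hf y) 0⟩
  -- If every `L i y` meets `C`, compactness gives a common point in `C`, which must be `f y`.
  have : f ⁻¹' C = ⋂ i, {y | (L i y ∩ C).Nonempty} := by
    ext y
    simp only [mem_preimage, mem_iInter, mem_ofPred_eq]
    refine ⟨fun h i => ⟨f y, mem_iInter.1 (hf y) i, h⟩, fun h => ?_⟩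
    obtain ⟨a, ha⟩ := IsCompact.nonempty_iInter_of_sequence_nonempty_isCompact_isClosed
      (fun i => L i y ∩ C) (fun i => inter_subset_inter_left _ (hanti i y)) h
      ((hLc 0 y).inter_right hC) fun i => (hLc i y).isClosed.inter hC
    rw [mem_iInter] at ha
    rw [← huniq y a (mem_iInter.2 fun i => (ha i).1)]
    exact (ha 0).2
  rw [this]
  exact MeasurableSet.iInter fun i => hLm i C hC

/-! ### Operations preserving lower semicontinuity -/

/-- Fatou's lemma for lower semicontinuous integrands depending on a parameter. -/
theorem LowerSemicontinuous.lintegral {X Ω : Type*} [TopologicalSpace X]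
    [FirstCountableTopology X] [MeasurableSpace Ω] {P : Measure Ω} {F : X → Ω → ℝ≥0∞}
    (hF : ∀ ω, LowerSemicontinuous fun x => F x ω) (hm : ∀ x, Measurable (F x)) :
    LowerSemicontinuous fun x => ∫⁻ ω, F x ω ∂P := by
  rw [lowerSemicontinuous_iff_le_liminf]
  intro x
  exact (lintegral_mono fun ω => (hF ω).le_liminf x).trans (lintegral_liminf_le hm)

-- Off the closed set the value is `⊤` on a whole neighbourhood; near a point of `S`, points outside
-- `S` only raise the function. This encodes admissibility of actions.
open Classical in
theorem LowerSemicontinuous.extend_top {X : Type*} [TopologicalSpace X] {S : Set X}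
    (hS : IsClosed S) {f : S → ℝ≥0∞} (hf : LowerSemicontinuous f) :
    LowerSemicontinuous fun x => if h : x ∈ S then f ⟨x, h⟩ else ⊤ := by
  intro x c hc
  by_cases hx : x ∈ S
  · simp only [hx, dite_true] at hc
    have := (eventually_nhds_subtype_iff S ⟨x, hx⟩
      (fun x => c < if h : x ∈ S then f ⟨x, h⟩ else ⊤)).1 (by
        filter_upwards [hf _ c hc] with q hq
        simpa using hq)
    rw [eventually_nhdsWithin_iff] at this
    filter_upwards [this] with q hq
    by_cases hqS : q ∈ S
    · exact hq hqS
    · simp only [hqS, dite_false] at hc ⊢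
      exact lt_top_of_lt hc
  · simp only [hx, dite_false] at hc
    filter_upwards [hS.isOpen_compl.mem_nhds hx] with q hq
    simpa [show q ∉ S from hq] using hc

/-- Minimisation over a fibre with sequentially compact behaviour preserves lower
semicontinuity. -/
theorem LowerSemicontinuous.iInf_of_upperSemicontinuous {X A : Type*} [TopologicalSpace X]
    [FirstCountableTopology X] [TopologicalSpace A] {S : Set (X × A)}
    (hS : ∀ (xs : ℕ → X) (x : X) (as : ℕ → A), Filter.Tendsto xs Filter.atTop (𝓝 x) →
      (∀ k, (xs k, as k) ∈ S) → ∃ a, MapClusterPt a Filter.atTop as)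
    {v : X × A → ℝ≥0∞} (hv : LowerSemicontinuous v) (htop : ∀ q, q ∉ S → v q = ⊤) :
    LowerSemicontinuous fun x => ⨅ a, v (x, a) := by
  intro x c hc
  by_contra hcon
  -- The infima at the `xs k` need not be attained; the gap between `c` and `c'` leaves room for
  -- near-minimisers.
  obtain ⟨c', hcc', hc'⟩ := exists_between hc
  obtain ⟨xs, hxs, hle⟩ := Filter.exists_seq_forall_of_frequently (Filter.not_eventually.1 hcon)
  have hex : ∀ k, ∃ a, v (xs k, a) < c' := fun k =>
    iInf_lt_iff.1 ((not_lt.1 (hle k)).trans_lt hcc')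
  choose as has using hex
  obtain ⟨a, ha⟩ := hS xs x as hxs fun k => by
    by_contra h
    have := has k
    rw [htop _ h] at this
    exact not_top_lt this
  have hva := hv (x, a) c' (hc'.trans_le (iInf_le _ a))
  rw [nhds_prod_eq] at hva
  obtain ⟨p, hp, q, hq, hpq⟩ := Filter.eventually_prod_iff.1 hva
  obtain ⟨k, hk1, hk2⟩ := ((ha.frequently hq).and_eventually (hxs.eventually hp)).exists
  exact lt_asymm (has k) (hpq hk2 hk1)

/-- A lower semicontinuous function, monotone in its last argument, may be composed with a lower
semicontinuous map in that argument. -/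
theorem LowerSemicontinuous.comp_monotone {X Y R : Type*} [TopologicalSpace X]
    [TopologicalSpace Y] [TopologicalSpace R] [LinearOrder R] [OrderTopology R]
    {W : Y × R → ℝ≥0∞} (hW : LowerSemicontinuous W) (hmono : ∀ y, Monotone fun r => W (y, r))
    {u : X → Y} (hu : Continuous u) {r : X → R} (hr : LowerSemicontinuous r) :
    LowerSemicontinuous fun x => W (u x, r x) := by
  intro x c hc
  -- Truncation at `r x` turns lower semicontinuity at `x` into convergence; monotonicity undoes the
  -- truncation.
  have ht : Filter.Tendsto (fun x' => min (r x') (r x)) (𝓝 x) (𝓝 (r x)) := by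
    refine tendsto_order.2 ⟨fun b hb => ?_, fun b hb => ?_⟩
    · filter_upwards [hr x b hb] with x' hx' using lt_min hx' hb
    · exact Filter.Eventually.of_forall fun x' => (min_le_right _ _).trans_lt hb
  filter_upwards [((hu.tendsto x).prodMk_nhds ht).eventually (hW (u x, r x) c hc)] with x' hx'
  exact hx'.trans_le (hmono _ (min_le_left _ _))

/-! ### Evaluation on `GSpace` and independence -/

theorem abs_sub_lt_of_compactDist_lt {f g : ℝ → ℝ} (hf : Continuous f) (hg : Continuous g)
    {j : ℕ} {s ε : ℝ} (hs : s ∈ Icc (-((j + 1 : ℕ) : ℝ)) ((j + 1 : ℕ) : ℝ)) (hε : 0 < ε)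
    (h : compactDist f g < (1 / 2) ^ (j + 1) * (ε / (1 + ε))) : |f s - g s| < ε := by
  have h1 := ((compactDist_summable f g).le_tsum j
    fun i _ => compactDist_term_nonneg f g i).trans_lt h
  have h2 := lt_of_mul_lt_mul_left h1 (by positivity)
  have h3 := compactGap_nonneg f g (j + 1)
  rw [div_lt_div_iff₀ (by linarith) (by linarith)] at h2
  exact (le_compactGap hf hg hs).trans_lt (by linarith)

/-- The common Lipschitz constant `φ 1` upgrades continuity in `g` at each fixed point to joint
continuity. -/
theorem GSpace.continuous_eval {φ : I → ℝ≥0} {ρ : ℝ} :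
    Continuous fun p : GSpace φ ρ × ℝ => p.1.toFun p.2 := by
  have hs (s : ℝ) : Continuous fun g : GSpace φ ρ => g.toFun s := by
    rw [Metric.continuous_iff]
    intro g ε hε
    obtain ⟨j, hj⟩ := exists_nat_ge |s|
    refine ⟨(1 / 2) ^ (j + 1) * (ε / (1 + ε)), by positivity, fun f hfg => ?_⟩
    refine abs_sub_lt_of_compactDist_lt f.lipschitz.continuous g.lipschitz.continuous ?_ hε hfg
    rw [mem_Icc, ← abs_le]
    push_cast
    linarith
  exact continuous_prod_of_continuous_lipschitzWith' _ (φ 1) (fun g => g.lipschitz) hs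

/-- Integrating out one coordinate of an independent family. -/
theorem iIndepFun_lintegral_split {ι 𝒵 Ω : Type*} [Fintype ι] [DecidableEq ι] [MeasurableSpace 𝒵]
    [MeasurableSpace Ω] {P : Measure Ω} [IsProbabilityMeasure P] {Z : ι → Ω → 𝒵}
    (hZ : iIndepFun Z P) (hm : ∀ i, Measurable (Z i)) (j : ι) {Φ : 𝒵 × (ι → 𝒵) → ℝ≥0∞}
    (hΦ : Measurable Φ) (hj : ∀ u zs z, Φ (u, Function.update zs j z) = Φ (u, zs)) :
    ∫⁻ ω, Φ (Z j ω, fun i => Z i ω) ∂P = ∫⁻ ω, ∫⁻ ω', Φ (Z j ω, fun i => Z i ω') ∂P ∂P := by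
  obtain ⟨ω₀⟩ := nonempty_of_isProbabilityMeasure P
  -- Since `Φ` ignores coordinate `j` of its second argument, that coordinate can be frozen at any
  -- `z₀`. What remains depends on the other disturbances only and is independent of `Z j`.
  set z₀ := Z j ω₀
  let S : Finset ι := {j}ᶜ
  let e : (S → 𝒵) → ι → 𝒵 := fun w i => if h : i ∈ S then w ⟨i, h⟩ else z₀
  have he : Measurable e := by
    refine measurable_pi_lambda _ fun i => ?_
    by_cases h : i ∈ S
    · simpa [e, h] using measurable_pi_apply (⟨i, h⟩ : S)
    · simp [e, h]
  have hZe (ω : Ω) : e (fun i : S => Z i ω) = Function.update (fun i => Z i ω) j z₀ := by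
    funext i
    by_cases h : i = j
    · subst h; simp [e, S]
    · simp [e, S, h]
  have hI : IndepFun (Z j) (fun ω => e fun i : S => Z i ω) P :=
    (hZ.indepFun_finset {j} S (by simp [S]) hm).comp
      (measurable_pi_apply (⟨j, by simp⟩ : ({j} : Finset ι))) he
  have hme : Measurable fun ω => e fun i : S => Z i ω :=
    he.comp (measurable_pi_lambda _ fun i => hm i)
  have hstep (u : 𝒵) (ω : Ω) : Φ (u, fun i => Z i ω) = Φ (u, e fun i : S => Z i ω) := by
    rw [hZe, hj]
  simp_rw [hstep]
  rw [← lintegral_map (f := Φ) (g := fun ω => (Z j ω, e fun i : S => Z i ω)) hΦ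
    ((hm j).prodMk hme), hI.map_prod_eq_prod_map_map (hm j).aemeasurable hme.aemeasurable,
    lintegral_prod _ hΦ.aemeasurable, lintegral_map hΦ.lintegral_prod_right' (hm j)]
  refine lintegral_congr fun ω => ?_
  exact lintegral_map (f := fun zs => Φ (Z j ω, zs)) (hΦ.comp measurable_prodMk_left) hme

/-! ### Recursions for the process, the cost and the policy value -/

namespace DecisionModel

section

variable {E A 𝒵 Ω : Type*} [MeasurableSpace E] [MeasurableSpace A]
  [MeasurableSpace 𝒵] [MeasurableSpace Ω] {P : Measure Ω} {N : ℕ}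

theorem process_of_le (M : DecisionModel E A 𝒵 Ω P N) (π : M.MarkovPolicy) (n : Fin (N + 1))
    (y : ExtState E) (ω : Ω) {k : Fin (N + 1)} (hk : k ≤ n) : M.process π n y ω k = y := by
  induction k using Fin.induction with
  | zero => rfl
  | succ j _ =>
    rw [process, Fin.induction_succ, if_neg (not_le.2 (Fin.castSucc_lt_iff_succ_le.2 hk))]

theorem process_succ (M : DecisionModel E A 𝒵 Ω P N) (π : M.MarkovPolicy) {n : Fin (N + 1)}
    (y : ExtState E) (ω : Ω) {k : Fin N} (hk : n ≤ k.castSucc) :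
    M.process π n y ω k.succ = M.extT k (M.process π n y ω k.castSucc)
      (π.rule k (M.process π n y ω k.castSucc)) (π.admissible k _) (M.Z k ω) := by
  conv_lhs => rw [process, Fin.induction_succ, if_pos hk]
  rfl

/-- The state following `y` at time `j` under the decision rule of `π` and disturbance `z`. -/
def step (M : DecisionModel E A 𝒵 Ω P N) (π : M.MarkovPolicy) (j : Fin N) (y : ExtState E)
    (z : 𝒵) : ExtState E :=
  M.extT j y (π.rule j y) (π.admissible j y) z

/-- Flow property: the two processes agree at time `j + 1` and obey the same recursion afterwards.
-/
theorem process_castSucc (M : DecisionModel E A 𝒵 Ω P N) (π : M.MarkovPolicy) (j : Fin N)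
    (y : ExtState E) (ω : Ω) {k : Fin (N + 1)} (hk : j.succ ≤ k) :
    M.process π j.castSucc y ω k = M.process π j.succ (M.step π j y (M.Z j ω)) ω k := by
  induction k using Fin.induction with
  | zero => simp at hk
  | succ k ih =>
    rcases hk.eq_or_lt with h | h
    · obtain rfl := Fin.succ_injective _ h
      rw [process_succ _ _ _ _ le_rfl, process_of_le _ _ _ _ _ le_rfl,
        process_of_le _ _ _ _ _ le_rfl]
      rfl
    · have hk' : j.succ ≤ k.castSucc := Fin.le_castSucc_iff.2 h
      rw [process_succ _ _ _ _ ((Fin.castSucc_lt_succ).le.trans hk'), process_succ _ _ _ _ hk']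
      simp only [ih hk']

theorem costFrom_castSucc (M : DecisionModel E A 𝒵 Ω P N) (π : M.MarkovPolicy) (j : Fin N)
    (y : ExtState E) (ω : Ω) :
    M.costFrom π j.castSucc y ω =
      M.c j (⟨(y.1, π.rule j y), π.admissible j y⟩, (M.step π j y (M.Z j ω)).1) +
        M.β * M.costFrom π j.succ (M.step π j y (M.Z j ω)) ω := by
  have hset : ({k : Fin N | j.castSucc ≤ k.castSucc} : Finset (Fin N)) =
      insert j ({k : Fin N | j.succ ≤ k.castSucc} : Finset (Fin N)) := by
    ext k
    simp only [Finset.mem_filter_univ, Finset.mem_insert, Fin.le_def, Fin.ext_iff,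
      Fin.val_castSucc, Fin.val_succ]
    omega
  unfold costFrom
  rw [hset, Finset.sum_insert (by simp [Fin.le_def]), mul_add, Finset.mul_sum, add_assoc]
  congr 1
  · simp only [process_succ M π y ω (le_refl j.castSucc),
      process_of_le M π _ y ω (le_refl j.castSucc), Fin.val_castSucc, tsub_self, pow_zero, one_mul]
    rfl
  congr 1
  · refine Finset.sum_congr rfl fun k hk => ?_
    have hk' : j.succ ≤ k.castSucc := (Finset.mem_filter.1 hk).2
    have hp : (k : ℕ) - (j.castSucc : ℕ) = (k - (j.succ : ℕ)) + 1 := by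
      simp only [Fin.le_def, Fin.val_castSucc, Fin.val_succ] at hk' ⊢
      omega
    simp only [process_castSucc M π j y ω hk',
      process_castSucc M π j y ω (hk'.trans (Fin.castSucc_lt_succ).le)]
    rw [hp, pow_succ]
    ring
  · have hp : N - (j.castSucc : ℕ) = (N - (j.succ : ℕ)) + 1 := by
      have := j.2
      simp only [Fin.val_castSucc, Fin.val_succ]
      omega
    rw [process_castSucc M π j y ω (Fin.le_last _), hp, pow_succ]
    ring

/-- Total cost at the end of the horizon, as a function of the disturbances. -/
def totalCost (M : DecisionModel E A 𝒵 Ω P N) (π : M.MarkovPolicy) (n : Fin (N + 1)) :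
    ExtState E → (Fin N → 𝒵) → ℝ≥0 :=
  Fin.reverseInduction (motive := fun _ => ExtState E → (Fin N → 𝒵) → ℝ≥0)
    (fun y _ => y.2.1 + y.2.2 * M.cN y.1) (fun j S y zs => S (M.step π j y (zs j)) zs) n

theorem totalCost_last (M : DecisionModel E A 𝒵 Ω P N) (π : M.MarkovPolicy) (y : ExtState E)
    (zs : Fin N → 𝒵) : M.totalCost π (Fin.last N) y zs = y.2.1 + y.2.2 * M.cN y.1 := by
  simp [totalCost]

theorem totalCost_castSucc (M : DecisionModel E A 𝒵 Ω P N) (π : M.MarkovPolicy) (j : Fin N)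
    (y : ExtState E) (zs : Fin N → 𝒵) :
    M.totalCost π j.castSucc y zs = M.totalCost π j.succ (M.step π j y (zs j)) zs := by
  simp [totalCost]

/-- With `s' = s + t c` and `t' = β t`, one has `s' + t' C' = s + t (c + β C')`, so a transition
preserves the total. The right side is a function of the disturbance vector, the form in which
independence applies. -/
theorem add_mul_costFrom (M : DecisionModel E A 𝒵 Ω P N) (π : M.MarkovPolicy) (n : Fin (N + 1))
    (y : ExtState E) (ω : Ω) :
    y.2.1 + y.2.2 * M.costFrom π n y ω = M.totalCost π n y fun k => M.Z k ω := by
  induction n using Fin.reverseInduction generalizing y with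
  | last =>
    rw [totalCost_last]
    simp [costFrom, process_of_le]
  | cast j ih =>
    rw [totalCost_castSucc, ← ih, costFrom_castSucc]
    simp only [step, extT]
    ring

theorem measurable_step (M : DecisionModel E A 𝒵 Ω P N) (π : M.MarkovPolicy) (j : Fin N) :
    Measurable fun q : ExtState E × 𝒵 => M.step π j q.1 q.2 := by
  have h1 : Measurable fun q : ExtState E × 𝒵 =>
      (⟨(q.1.1, π.rule j q.1), π.admissible j q.1⟩ : M.D j) :=
    Measurable.subtype_mk (measurable_fst.fst.prodMk ((π.measurable_rule j).comp measurable_fst))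
  have h2 := (M.measurable_T j).comp (h1.prodMk measurable_snd)
  have h3 := (M.measurable_c j).comp (h1.prodMk h2)
  refine h2.prodMk (Measurable.prodMk ?_ (Measurable.subtype_mk ?_))
  · exact measurable_fst.snd.fst.add
      ((measurable_subtype_coe.comp measurable_fst.snd.snd).mul h3)
  · exact (measurable_subtype_coe.comp measurable_fst.snd.snd).const_mul _

theorem measurable_totalCost (M : DecisionModel E A 𝒵 Ω P N) (π : M.MarkovPolicy)
    (n : Fin (N + 1)) :
    Measurable fun q : ExtState E × (Fin N → 𝒵) => M.totalCost π n q.1 q.2 := by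
  induction n using Fin.reverseInduction with
  | last =>
    simp only [totalCost_last]
    exact measurable_fst.snd.fst.add ((measurable_subtype_coe.comp measurable_fst.snd.snd).mul
      (M.measurable_cN.comp measurable_fst.fst))
  | cast j ih =>
    simp only [totalCost_castSucc]
    exact ih.comp (((M.measurable_step π j).comp (measurable_fst.prodMk
      ((measurable_pi_apply j).comp measurable_snd))).prodMk measurable_snd)

/-- This supplies the invariance hypothesis of `iIndepFun_lintegral_split`. -/
theorem totalCost_update (M : DecisionModel E A 𝒵 Ω P N) (π : M.MarkovPolicy) (n : Fin (N + 1))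
    {j : Fin N} (hj : j.castSucc < n) (y : ExtState E) (zs : Fin N → 𝒵) (z : 𝒵) :
    M.totalCost π n y (Function.update zs j z) = M.totalCost π n y zs := by
  induction n using Fin.reverseInduction generalizing y with
  | last => simp only [totalCost_last]
  | cast k ih =>
    have hne : k ≠ j := by rintro rfl; exact lt_irrefl _ hj
    rw [totalCost_castSucc, totalCost_castSucc, ih (hj.trans (Fin.castSucc_lt_succ)),
      Function.update_of_ne hne]

theorem totalCost_congr (M : DecisionModel E A 𝒵 Ω P N) {π π' : M.MarkovPolicy} (n : Fin (N + 1))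
    (h : ∀ k : Fin N, n ≤ k.castSucc → π.rule k = π'.rule k) (y : ExtState E)
    (zs : Fin N → 𝒵) : M.totalCost π n y zs = M.totalCost π' n y zs := by
  induction n using Fin.reverseInduction generalizing y with
  | last => simp only [totalCost_last]
  | cast k ih =>
    rw [totalCost_castSucc, totalCost_castSucc,
      ih fun i hi => h i ((Fin.castSucc_lt_succ).le.trans hi)]
    simp only [step, h k le_rfl]

theorem policyValue_eq (M : DecisionModel E A 𝒵 Ω P N) (π : M.MarkovPolicy) (g : ℝ → ℝ)
    (n : Fin (N + 1)) (y : ExtState E) :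
    M.policyValue π g n y =
      ∫⁻ ω, ENNReal.ofReal (g (M.totalCost π n y fun k => M.Z k ω)) ∂P := by
  simp only [policyValue, add_mul_costFrom]

theorem policyValue_congr (M : DecisionModel E A 𝒵 Ω P N) {π π' : M.MarkovPolicy} (g : ℝ → ℝ)
    (n : Fin (N + 1)) (h : ∀ k : Fin N, n ≤ k.castSucc → π.rule k = π'.rule k)
    (y : ExtState E) : M.policyValue π g n y = M.policyValue π' g n y := by
  simp only [policyValue_eq, M.totalCost_congr n h]

theorem policyValue_last (M : DecisionModel E A 𝒵 Ω P N) [IsProbabilityMeasure P]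
    (π : M.MarkovPolicy) (g : ℝ → ℝ) (y : ExtState E) :
    M.policyValue π g (Fin.last N) y = ENNReal.ofReal (g (y.2.1 + y.2.2 * M.cN y.1 : ℝ≥0)) := by
  simp [policyValue_eq, totalCost_last]

/-- Reward iteration. -/
theorem policyValue_castSucc (M : DecisionModel E A 𝒵 Ω P N) [IsProbabilityMeasure P]
    (π : M.MarkovPolicy) {g : ℝ → ℝ} (hg : Measurable g) (j : Fin N) (y : ExtState E) :
    M.policyValue π g j.castSucc y =
      ∫⁻ ω, M.policyValue π g j.succ (M.step π j y (M.Z j ω)) ∂P := by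
  simp only [policyValue_eq, totalCost_castSucc]
  refine iIndepFun_lintegral_split M.indep_Z M.measurable_Z j
    (Φ := fun q => ENNReal.ofReal (g (M.totalCost π j.succ (M.step π j y q.1) q.2))) ?_ ?_
  · refine (hg.comp (measurable_coe_nnreal_real.comp ((M.measurable_totalCost π j.succ).comp
      (Measurable.prodMk ?_ measurable_snd)))).ennreal_ofReal
    exact (M.measurable_step π j).comp (measurable_const.prodMk measurable_fst)
  · intro u zs z
    simp only [M.totalCost_update π j.succ (Fin.castSucc_lt_succ)]

/-! ### The Bellman operator -/

theorem nonempty_markovPolicy (M : DecisionModel E A 𝒵 Ω P N) : Nonempty M.MarkovPolicy := by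
  choose f hf hfD using M.exists_graph_subset
  exact ⟨⟨fun n y => f n y.1, fun n => (hf n).comp measurable_fst, fun n y => hfD n y.1⟩⟩

theorem measurable_extT (M : DecisionModel E A 𝒵 Ω P N) (j : Fin N) (y : ExtState E) (a : A)
    (h : (y.1, a) ∈ M.D j) : Measurable (M.extT j y a h) := by
  have h2 := (M.measurable_T j).comp
    (measurable_prodMk_left (x := (⟨(y.1, a), h⟩ : M.D j)))
  have h3 := (M.measurable_c j).comp (measurable_const (a := (⟨(y.1, a), h⟩ : M.D j)) |>.prodMk h2)
  exact h2.prodMk ((measurable_const.add (h3.const_mul _)).prodMk measurable_const)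

open Classical in
/-- The expected value of `W` after taking the action `a` at time `j` in the state `y`; it is `⊤`
for inadmissible actions. -/
noncomputable def actionValue (M : DecisionModel E A 𝒵 Ω P N) {X : Type*}
    (W : X × ExtState E → ℝ≥0∞) (j : Fin N) (q : (X × ExtState E) × A) : ℝ≥0∞ :=
  if h : (q.1.2.1, q.2) ∈ M.D j then
    ∫⁻ ω, W (q.1.1, M.extT j q.1.2 q.2 h (M.Z j ω)) ∂P else ⊤

theorem actionValue_of_mem (M : DecisionModel E A 𝒵 Ω P N) {X : Type*}
    (W : X × ExtState E → ℝ≥0∞) (j : Fin N) (g : X) (y : ExtState E) (a : A)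
    (h : (y.1, a) ∈ M.D j) : M.actionValue W j ((g, y), a) =
      ∫⁻ ω, W (g, M.extT j y a h (M.Z j ω)) ∂P :=
  dif_pos h

theorem actionValue_of_notMem (M : DecisionModel E A 𝒵 Ω P N) {X : Type*}
    (W : X × ExtState E → ℝ≥0∞) (j : Fin N) (q : (X × ExtState E) × A)
    (h : (q.1.2.1, q.2) ∉ M.D j) : M.actionValue W j q = ⊤ :=
  dif_neg h

theorem actionValue_mono (M : DecisionModel E A 𝒵 Ω P N) {X : Type*}
    {W : X × ExtState E → ℝ≥0∞}
    (hW : ∀ g x t, Monotone fun s => W (g, x, s, t)) (j : Fin N) (g : X) (x : E)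
    (t : Ioi (0 : ℝ≥0)) (a : A) :
    Monotone fun s => M.actionValue W j ((g, x, s, t), a) := by
  intro s s' hs
  by_cases h : (x, a) ∈ M.D j
  · simp only [M.actionValue_of_mem W j g (x, _, t) a h]
    exact lintegral_mono fun ω => hW _ _ _ (add_le_add_left hs _)
  · simp only [M.actionValue_of_notMem W j ((g, x, s', t), a) h, le_top]

theorem step_eq_actionValue (M : DecisionModel E A 𝒵 Ω P N) {X : Type*}
    (W : X × ExtState E → ℝ≥0∞) (π : M.MarkovPolicy) (j : Fin N) (g : X) (y : ExtState E) :
    ∫⁻ ω, W (g, M.step π j y (M.Z j ω)) ∂P = M.actionValue W j ((g, y), π.rule j y) :=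
  (M.actionValue_of_mem W j g y _ (π.admissible j y)).symm

/-- Changing the rule at time `j` leaves the value from `j + 1` on untouched, so any admissible
measurable rule can be put in front of a given continuation. -/
theorem policyValue_update (M : DecisionModel E A 𝒵 Ω P N) [IsProbabilityMeasure P]
    {X : Type*} {W : X × ExtState E → ℝ≥0∞} {g : ℝ → ℝ} (hg : Measurable g) {G : X}
    {j : Fin N} {π : M.MarkovPolicy} (hπ : ∀ y, M.policyValue π g j.succ y = W (G, y))
    {f : ExtState E → A} (hf : Measurable f) (hfD : ∀ y, (y.1, f y) ∈ M.D j) :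
    ∃ π' : M.MarkovPolicy, ∀ y,
      M.policyValue π' g j.castSucc y = M.actionValue W j ((G, y), f y) := by
  let π' : M.MarkovPolicy := ⟨Function.update π.rule j f, fun k => by
    rcases eq_or_ne k j with rfl | hk
    · simpa using hf
    · simpa [hk] using π.measurable_rule k, fun k y => by
    rcases eq_or_ne k j with rfl | hk
    · simpa using hfD y
    · simpa [hk] using π.admissible k y⟩
  refine ⟨π', fun y => ?_⟩
  have hrule : π'.rule j y = f y := by simp [π']
  rw [policyValue_castSucc M π' hg, ← hrule, ← step_eq_actionValue]
  refine lintegral_congr fun ω => ?_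
  rw [← hπ]
  refine M.policyValue_congr g _ (fun k hk => ?_) _
  have : k ≠ j := by rintro rfl; exact absurd hk (not_le.2 Fin.castSucc_lt_succ)
  simp [π', this]

end

/-! ### Semicontinuity and minimisers for the Bellman operator -/

section

variable {E A 𝒵 Ω : Type*}
  [TopologicalSpace E] [TopologicalSpace.MetrizableSpace E] [MeasurableSpace E]
  [TopologicalSpace A] [MeasurableSpace A]
  [MeasurableSpace 𝒵] [MeasurableSpace Ω] {P : Measure Ω} {N : ℕ}
  {M : DecisionModel E A 𝒵 Ω P N}

/-- An accumulation point of a convergent sequence of actions is its limit, by the Hausdorff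
property. -/
theorem ContinuityCompactness.isClosed_D [TopologicalSpace.MetrizableSpace A]
    (hM : M.ContinuityCompactness) (j : Fin N) : IsClosed (M.D j) := by
  refine IsSeqClosed.isClosed fun q p hq hp => ?_
  obtain ⟨a, ha, hc⟩ := hM.upperSemicontinuous_section j (fun k => (q k).1) p.1
    (fun k => (q k).2) ((continuous_fst.tendsto p).comp hp) hq
  have hlim : Filter.Tendsto (fun k => (q k).2) Filter.atTop (𝓝 p.2) :=
    (continuous_snd.tendsto p).comp hp
  have hap : a = p.2 := eq_of_nhds_neBot (hc.clusterPt.mono hlim : ClusterPt a (𝓝 p.2))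
  rwa [hap] at ha

variable {X : Type*} [TopologicalSpace X] [FirstCountableTopology X]
  {W : X × ExtState E → ℝ≥0∞}

theorem lowerSemicontinuous_iInf_action (hM : M.ContinuityCompactness) (j : Fin N)
    {v : (X × ExtState E) × A → ℝ≥0∞} (hv : LowerSemicontinuous v)
    (htop : ∀ q, (q.1.2.1, q.2) ∉ M.D j → v q = ⊤) :
    LowerSemicontinuous fun p => ⨅ a, v (p, a) := by
  refine LowerSemicontinuous.iInf_of_upperSemicontinuous
    (S := {q : (X × ExtState E) × A | (q.1.2.1, q.2) ∈ M.D j}) (fun xs x as hxs has => ?_) hv htop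
  obtain ⟨a, -, ha⟩ := hM.upperSemicontinuous_section j (fun k => (xs k).2.1) x.2.1 as
    (((continuous_fst.comp continuous_snd).tendsto x).comp hxs) has
  exact ⟨a, ha⟩

variable [TopologicalSpace.MetrizableSpace A] [BorelSpace E]

theorem lowerSemicontinuous_actionValue (hM : M.ContinuityCompactness)
    (hW : LowerSemicontinuous W) (hmono : ∀ g x t, Monotone fun s => W (g, x, s, t))
    (j : Fin N) : LowerSemicontinuous (M.actionValue W j) := by
  let S : Set ((X × ExtState E) × A) := {q | (q.1.2.1, q.2) ∈ M.D j}
  have hS : IsClosed S := (hM.isClosed_D j).preimage (by fun_prop)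
  let F : S → Ω → ℝ≥0∞ := fun q ω => W (q.1.1.1, M.extT j q.1.1.2 q.1.2 q.2 (M.Z j ω))
  refine LowerSemicontinuous.extend_top hS (f := fun q => ∫⁻ ω, F q ω ∂P)
    (LowerSemicontinuous.lintegral (fun ω => ?_) fun q => ?_)
  · let i : S → M.D j := fun q => ⟨(q.1.1.2.1, q.1.2), q.2⟩
    have hi : Continuous i := Continuous.subtype_mk (by fun_prop) _
    have hT : Continuous fun q : S => M.T j (i q, M.Z j ω) := (hM.continuous_T j _).comp hi
    have hc : LowerSemicontinuous fun q : S => M.c j (i q, M.T j (i q, M.Z j ω)) :=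
      (hM.lowerSemicontinuous_c j).comp (hi.prodMk hT)
    have hβ : Continuous fun t : Ioi (0 : ℝ≥0) =>
        (⟨M.β * t, mul_pos M.β_pos t.2⟩ : Ioi (0 : ℝ≥0)) :=
      Continuous.subtype_mk (by fun_prop) _
    -- The one-stage cost becomes a separate last argument: all other arguments vary continuously
    -- and `W` is monotone in this one, so lower semicontinuity of the cost suffices.
    have hW' : LowerSemicontinuous fun p : (X × E × ℝ≥0 × Ioi (0 : ℝ≥0)) × ℝ≥0 =>
        W (p.1.1, p.1.2.1, p.1.2.2.1 + p.1.2.2.2 * p.2,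
          ⟨M.β * p.1.2.2.2, mul_pos M.β_pos p.1.2.2.2.2⟩) :=
      hW.comp (g := fun p : (X × E × ℝ≥0 × Ioi (0 : ℝ≥0)) × ℝ≥0 =>
        ((p.1.1, p.1.2.1, p.1.2.2.1 + p.1.2.2.2 * p.2,
          ⟨M.β * p.1.2.2.2, mul_pos M.β_pos p.1.2.2.2.2⟩) : X × ExtState E))
        (by fun_prop)
    exact hW'.comp_monotone (fun y r r' h => hmono _ _ _ (by gcongr))
      (u := fun q : S => (q.1.1.1, M.T j (i q, M.Z j ω), q.1.1.2.2.1, q.1.1.2.2.2))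
      (by fun_prop) hc
  · have h1 : Measurable fun y : ExtState E => W (q.1.1.1, y) :=
      (hW.comp (Continuous.prodMk_right q.1.1.1)).measurable
    exact h1.comp ((M.measurable_extT j _ _ q.2).comp (M.measurable_Z j))

variable [SecondCountableTopology A] [BorelSpace A]

/-- The minimisers form a nonempty compact set `K y`. Since minima over closed parts of `D y` are
attained, `K y` meets a closed `C` exactly when `D y` does and the minimum over `C` does not exceed
the global one; both conditions compare measurable functions of `y`. -/
theorem exists_measurable_minimizer (hM : M.ContinuityCompactness)
    (hW : LowerSemicontinuous W) (hmono : ∀ g x t, Monotone fun s => W (g, x, s, t))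
    (j : Fin N) (g : X) : ∃ f : ExtState E → A, Measurable f ∧ (∀ y, (y.1, f y) ∈ M.D j) ∧
      ∀ y, M.actionValue W j ((g, y), f y) = ⨅ a, M.actionValue W j ((g, y), a) := by
  classical
  have hv := lowerSemicontinuous_actionValue hM hW hmono j
  have htop := M.actionValue_of_notMem W j
  have hsec (y : ExtState E) : LowerSemicontinuous fun a => M.actionValue W j ((g, y), a) :=
    hv.comp (Continuous.prodMk_right (g, y))
  have hV : Measurable fun y => ⨅ a, M.actionValue W j ((g, y), a) :=
    ((lowerSemicontinuous_iInf_action hM j hv htop).comp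
      (Continuous.prodMk_right g)).measurable
  let D : ExtState E → Set A := fun y => {a | (y.1, a) ∈ M.D j}
  have hD (y : ExtState E) : IsCompact (D y) := hM.isCompact_section j y.1
  have hatt (C : Set A) (hC : IsClosed C) (y : ExtState E) (hne : (D y ∩ C).Nonempty) :
      ∃ a ∈ D y ∩ C, ∀ b ∈ D y ∩ C,
        M.actionValue W j ((g, y), a) ≤ M.actionValue W j ((g, y), b) := by
    obtain ⟨a, ha, hmin⟩ := LowerSemicontinuousOn.exists_isMinOn hne ((hD y).inter_right hC)
      ((hsec y).lowerSemicontinuousOn _)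
    exact ⟨a, ha, fun b hb => hmin hb⟩
  let K : ExtState E → Set A := fun y =>
    D y ∩ {a | M.actionValue W j ((g, y), a) ≤ ⨅ b, M.actionValue W j ((g, y), b)}
  have hKne (y : ExtState E) : (K y).Nonempty := by
    obtain ⟨f₀, -, hf₀⟩ := M.exists_graph_subset j
    obtain ⟨a, ha, hmin⟩ := hatt univ isClosed_univ y ⟨f₀ y.1, hf₀ y.1, mem_univ _⟩
    refine ⟨a, ha.1, ?_⟩
    rw [mem_ofPred_eq]
    refine le_iInf fun b => ?_
    by_cases hb : (y.1, b) ∈ M.D j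
    · exact hmin b ⟨hb, mem_univ _⟩
    · rw [htop ((g, y), b) hb]; exact le_top
  have hKm (C : Set A) (hC : IsClosed C) : MeasurableSet {y | (K y ∩ C).Nonempty} := by
    have hres (w : (X × ExtState E) × A → ℝ≥0∞) (hw : LowerSemicontinuous w)
        (hwtop : ∀ q, (q.1.2.1, q.2) ∉ M.D j → w q = ⊤) :
        Measurable fun y => ⨅ a, if a ∈ C then w ((g, y), a) else ⊤ := by
      have := LowerSemicontinuous.extend_top (S := {q : (X × ExtState E) × A | q.2 ∈ C})
        (hC.preimage continuous_snd) (f := fun q => w q.1) (hw.comp continuous_subtype_val)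
      have := lowerSemicontinuous_iInf_action hM j this fun q hq => by
        by_cases h : q.2 ∈ C <;> simp [h, hwtop q hq]
      simpa [Function.comp_def] using (this.comp (Continuous.prodMk_right g)).measurable
    -- With value `0` on admissible actions and `⊤` elsewhere, nonemptiness of `D y ∩ C` becomes
    -- finiteness of an infimum. It is needed separately: where the global infimum is `⊤`, comparing
    -- infima says nothing.
    have hone := LowerSemicontinuous.extend_top
      (S := {q : (X × ExtState E) × A | (q.1.2.1, q.2) ∈ M.D j})
      ((hM.isClosed_D j).preimage (by fun_prop)) (f := fun _ => 0) lowerSemicontinuous_const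
    have hm0 := hres _ hone fun q hq => by simp [hq]
    have hm1 := hres _ hv htop
    have : {y | (K y ∩ C).Nonempty} =
        {y | (⨅ a, if a ∈ C then (if h : (y.1, a) ∈ M.D j then (0 : ℝ≥0∞) else ⊤) else ⊤) < ⊤} ∩
        {y | (⨅ a, if a ∈ C then M.actionValue W j ((g, y), a) else ⊤) ≤
          ⨅ a, M.actionValue W j ((g, y), a)} := by
      ext y
      have h0 : (⨅ a, if a ∈ C then (if h : (y.1, a) ∈ M.D j then (0 : ℝ≥0∞) else ⊤) else ⊤) < ⊤ ↔
          (D y ∩ C).Nonempty := by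
        rw [iInf_lt_iff]
        refine exists_congr fun a => ?_
        by_cases h1 : a ∈ C <;> by_cases h2 : (y.1, a) ∈ M.D j <;> simp [h1, h2, D]
      rw [mem_inter_iff, mem_ofPred_eq, mem_ofPred_eq, mem_ofPred_eq, h0]
      constructor
      · rintro ⟨a, ⟨haD, hle⟩, haC⟩
        refine ⟨⟨a, haD, haC⟩, (iInf_le _ a).trans ?_⟩
        rw [if_pos haC]
        exact hle
      · rintro ⟨hne, hle⟩
        obtain ⟨a, ha, hmin⟩ := hatt C hC y hne
        refine ⟨a, ⟨ha.1, le_trans (le_iInf fun b => ?_) hle⟩, ha.2⟩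
        by_cases hb : b ∈ C
        · rw [if_pos hb]
          by_cases hb' : (y.1, b) ∈ M.D j
          · exact hmin b ⟨hb', hb⟩
          · rw [htop ((g, y), b) hb']; exact le_top
        · rw [if_neg hb]; exact le_top
    rw [this]
    exact (measurableSet_lt hm0 measurable_const).inter (measurableSet_le hm1 hV)
  obtain ⟨f, hf, hfK⟩ := exists_measurable_selection K
    (fun y => (hD y).inter_right ((hsec y).isClosed_preimage _)) hKne hKm
  exact ⟨f, hf, fun y => (hfK y).1, fun y => le_antisymm (hfK y).2 (iInf_le _ _)⟩

/-! ### Backward induction -/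

/-- The value functions are lower semicontinuous in the cost function and the state, increasing in
the accumulated cost, and attained by a Markov policy. -/
theorem valueFunction_structure [IsProbabilityMeasure P] (hM : M.ContinuityCompactness)
    (φ : I → ℝ≥0) (ρ : ℝ) (n : Fin (N + 1)) :
    (LowerSemicontinuous fun p : GSpace φ ρ × ExtState E =>
      M.valueFunction p.1.toFun n p.2) ∧
    (∀ (g : GSpace φ ρ) x t, Monotone fun s => M.valueFunction g.toFun n (x, s, t)) ∧
    ∀ g : GSpace φ ρ, ∃ π : M.MarkovPolicy, ∀ y,
      M.policyValue π g.toFun n y = M.valueFunction g.toFun n y := by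
  induction n using Fin.reverseInduction with
  | last =>
    obtain ⟨π₀⟩ := M.nonempty_markovPolicy
    have hval (g : ℝ → ℝ) (y : ExtState E) : M.valueFunction g (Fin.last N) y =
        ENNReal.ofReal (g (y.2.1 + y.2.2 * M.cN y.1 : ℝ≥0)) := by
      have : Nonempty M.MarkovPolicy := ⟨π₀⟩
      simp only [valueFunction, policyValue_last, ciInf_const]
    refine ⟨?_, fun g x t s s' hs => ?_, fun g => ⟨π₀, fun y => ?_⟩⟩
    · simp only [hval]
      have hcost : Continuous fun p : (GSpace φ ρ × ℝ≥0 × Ioi (0 : ℝ≥0)) × ℝ≥0 =>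
          p.1.2.1 + (p.1.2.2 : ℝ≥0) * p.2 := by fun_prop
      have hcont : Continuous fun p : (GSpace φ ρ × ℝ≥0 × Ioi (0 : ℝ≥0)) × ℝ≥0 =>
          ENNReal.ofReal (p.1.1.toFun (p.1.2.1 + p.1.2.2 * p.2 : ℝ≥0)) :=
        ENNReal.continuous_ofReal.comp (GSpace.continuous_eval.comp
          (continuous_fst.fst.prodMk (NNReal.continuous_coe.comp hcost)))
      exact hcont.lowerSemicontinuous.comp_monotone
        (fun y r r' h => ENNReal.ofReal_le_ofReal (y.1.monotone (by gcongr)))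
        (u := fun p : GSpace φ ρ × ExtState E => (p.1, p.2.2.1, p.2.2.2)) (by fun_prop)
        (hM.lowerSemicontinuous_cN.comp continuous_snd.fst)
    · simp only [hval]
      exact ENNReal.ofReal_le_ofReal (g.monotone (by gcongr))
    · rw [hval, policyValue_last]
  | cast j ih =>
    obtain ⟨hlsc, hmono, hopt⟩ := ih
    set W : GSpace φ ρ × ExtState E → ℝ≥0∞ := fun p => M.valueFunction p.1.toFun j.succ p.2
    have hopt' (g : GSpace φ ρ) : ∃ π : M.MarkovPolicy, ∀ y,
        M.policyValue π g.toFun j.castSucc y = ⨅ a, M.actionValue W j ((g, y), a) := by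
      obtain ⟨f, hf, hfD, hfmin⟩ := exists_measurable_minimizer hM hlsc hmono j g
      obtain ⟨π, hπ⟩ := hopt g
      obtain ⟨π', hπ'⟩ := M.policyValue_update (W := W) (G := g)
        g.lipschitz.continuous.measurable hπ hf hfD
      exact ⟨π', fun y => (hπ' y).trans (hfmin y)⟩
    have hval (g : GSpace φ ρ) (y : ExtState E) : M.valueFunction g.toFun j.castSucc y =
        ⨅ a, M.actionValue W j ((g, y), a) := by
      refine le_antisymm ?_ (le_iInf fun π => ?_)
      · obtain ⟨π, hπ⟩ := hopt' g
        exact (iInf_le _ π).trans_eq (hπ y)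
      -- No policy beats the infimum: its action at time `j` is one competitor, and its continuation
      -- costs at least `W`.
      · rw [policyValue_castSucc M π g.lipschitz.continuous.measurable]
        refine (iInf_le _ (π.rule j y)).trans ?_
        rw [← step_eq_actionValue]
        exact lintegral_mono fun ω => iInf_le _ π
    simp only [hval]
    refine ⟨?_, fun g x t s s' hs => ?_, hopt'⟩
    · exact lowerSemicontinuous_iInf_action hM j
        (lowerSemicontinuous_actionValue hM hlsc hmono j) (M.actionValue_of_notMem W j)
    · exact iInf_mono fun a => M.actionValue_mono hmono j g x t a hs

end

end DecisionModel

/-- Joint lower semicontinuity of the finite-horizon value functions in `(g,x,s,t)`. The state and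
action spaces are Borel spaces, i.e. (homeomorphic to) Borel subsets of Polish spaces:
separable metrizable spaces whose Borel sigma-algebra is standard. -/
theorem lemma7p3
    {E A 𝒵 Ω : Type*}
    [TopologicalSpace E] [TopologicalSpace.MetrizableSpace E] [SecondCountableTopology E]
    [MeasurableSpace E] [BorelSpace E] [StandardBorelSpace E]
    [TopologicalSpace A] [TopologicalSpace.MetrizableSpace A] [SecondCountableTopology A]
    [MeasurableSpace A] [BorelSpace A] [StandardBorelSpace A]
    [MeasurableSpace 𝒵] [MeasurableSpace Ω]
    (P : Measure Ω) [IsProbabilityMeasure P]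
    (N : ℕ) (M : DecisionModel E A 𝒵 Ω P N) (hM : M.ContinuityCompactness)
    (φ : I → ℝ≥0) (hφ : IsSpectrum φ) (ρ : ℝ) (n : Fin (N + 1)) :
    LowerSemicontinuous fun p : GSpace φ ρ × ExtState E =>
      M.valueFunction p.1.toFun n p.2 := by
  exact (DecisionModel.valueFunction_structure hM φ ρ n).1
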